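/- **Setting.** A power system has inflexible, flexible and stochastic generation with capacities $\overline p_I,\overline p_F,\overline p_W>0$, forward marginal costs $c_I>0$, $c_F>0$ and $0$, upward-regulation cost $c_F^+$, downward-regulation utility $c_F^-$ and load-curtailment cost $v$, with $v>c_F^+\ge c_F\ge c_F^-\ge 0$. The stochastic production is a random variable $W$ with $0\le W\le\overline p_W$ on a probability space $(\Omega,\mathcal F,P)$, with cumulative distribution function $F$; put $F^{-1}(\alpha)=\inf\{x\in\mathbb R: F(x)\ge\alpha\}\in[-\infty,\infty]$. The demand is $l$. A *plan* consists of a forward dispatch $(p_F,p_I,p_W)\in\mathbb R^3$ and measurable functions $p_F^+,p_F^-,\Delta p_W,s$ on $\Omega$. Its expected cost is $$c_Ip_I+c_Fp_F+\int_\Omega\big(v\,s+c_F^+p_F^+-c_F^-p_F^-\big)\,dP .$$ The *balancing constraints* are, for all $\omega\in\Omega$: $s+p_F^+-p_F^-+\Delta p_W=0$, $0\le p_F^-\le p_F$, $0\le p_F^+\le\overline p_F-p_F$, $0\le p_W+\Delta p_W\le W$, $0\le s\le l$. * The *stochastic market* minimizes the expected cost over plans that satisfy the balancing constraints, $p_F+p_I+p_W=l$,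 $0\le p_F\le\overline p_F$ and $0\le p_I\le\overline p_I$. * The *bilevel problem* (centralized dispatch of the stochastic production) minimizes the expected cost over plans that satisfy the balancing constraints, $0\le p_W\le\overline p_W$, and $$(p_F,p_I)\in\arg\min\{c_Fx_F+c_Ix_I:\ x_F+x_I+p_W=l,\ 0\le x_F\le\overline p_F,\ 0\le x_I\le\overline p_I\}.$$ Let $$l_1=F^{-1}\!\Big(\tfrac{c_F-c_F^-}{c_F^+-c_F^-}\Big),\qquad l_2=\min\{x\ge 0:\ (v-c_F^+)F(x-\overline p_F)+c_F^+F(x)\ge c_I\}$$ (the value of $l_1$ is immaterial when $c_F^+=c_F^-$, and condition 1 below is then not considered; condition 4 applies). When $c_I<c_F$, a plan *violates the merit order* if $p_I<\overline p_I$ and $p_F>0$. **Corollary (Cost-efficient merit-order dispatch solution).** Let $c_I<c_F$ and $0\le l\le\overline p_I+\overline p_F+\overline p_W$ (that is, the bilevel problem is feasible). Suppose that at least one of the following holds: 1. $l_1\ge l_2$, and, in case $l_1=l_2$, $P(W=l_1)=0$ (which is automatic if $W$ has a probability density function); 2. some solution of the stochastic market satisfies the merit order (does not violate it); 3. some solution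 of the stochastic market has $p_I=\overline p_I$; 4. $c_F=c_F^+=c_F^-$ (free upward and downward regulation). Then both the stochastic market and the bilevel problem have optimal solutions, and the expected cost of every solution of the bilevel problem equals the expected cost of every solution of the stochastic market. -/

import Mathlib

open MeasureTheory

/-- The stylized power system: inflexible, flexible and stochastic generation with capacities
`capI`, `capF`, `capW`; forward marginal costs `cI`, `cF` (zero for stochastic production);
cost `cUp` of upward regulation, utility `cDown` of downward regulation, and cost `v` of load
curtailment. The stochastic production `W` is a random variable on the probability space
`(Ω, P)`; it is nonnegative and does not exceed the stochastic capacity.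
No assumption is made on the type of the law of `W`. -/
structure PowerSystem (Ω : Type*) [MeasurableSpace Ω] where
  capI : ℝ
  capF : ℝ
  capW : ℝ
  cI : ℝ
  cF : ℝ
  cUp : ℝ
  cDown : ℝ
  v : ℝ
  P : Measure Ω
  W : Ω → ℝ
  capI_pos : 0 < capI
  capF_pos : 0 < capF
  capW_pos : 0 < capW
  cI_pos : 0 < cI
  cF_pos : 0 < cF
  cUp_lt_v : cUp < v
  cF_le_cUp : cF ≤ cUp
  cDown_le_cF : cDown ≤ cF
  cDown_nonneg : 0 ≤ cDown
  isProbabilityMeasure : IsProbabilityMeasure P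
  measurable_W : Measurable W
  W_nonneg : ∀ ω, 0 ≤ W ω
  W_le : ∀ ω, W ω ≤ capW

/-- The decision variables of a two-stage market: the forward dispatch `(pF, pI, pW)`, and in
each scenario the upward regulation `up`, the downward regulation `down`, the adjustment `dW`
of the stochastic production and the load curtailment `shed`. -/
structure MarketPlan (Ω : Type*) where
  pF : ℝ
  pI : ℝ
  pW : ℝ
  up : Ω → ℝ
  down : Ω → ℝ
  dW : Ω → ℝ
  shed : Ω → ℝ

namespace PowerSystem

variable {Ω : Type*} [MeasurableSpace Ω]

/-- The cumulative distribution function of the stochastic production. -/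
noncomputable def F (S : PowerSystem Ω) (x : ℝ) : ℝ :=
  (S.P {ω | S.W ω ≤ x}).toReal

/-- The generalized inverse `inf {x ∈ ℝ | F x ≥ α}`, in the extended reals
(`-∞` at `α = 0`). -/
noncomputable def Finv (S : PowerSystem Ω) (α : ℝ) : EReal :=
  sInf ((fun x : ℝ => (x : EReal)) '' {x : ℝ | α ≤ S.F x})

/-- The constant `l₁ = F⁻¹((cF - cDown) / (cUp - cDown))`. -/
noncomputable def l₁ (S : PowerSystem Ω) : EReal :=
  S.Finv ((S.cF - S.cDown) / (S.cUp - S.cDown))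

/-- The constant `l₂`, the least `x ≥ 0` with `(v - cUp) F(x - capF) + cUp F(x) ≥ cI`
(infinite if there is none). -/
noncomputable def l₂ (S : PowerSystem Ω) : EReal :=
  sInf ((fun x : ℝ => (x : EReal)) ''
    {x : ℝ | 0 ≤ x ∧ S.cI ≤ (S.v - S.cUp) * S.F (x - S.capF) + S.cUp * S.F x})

/-- The expected total system operating cost of a plan. -/
noncomputable def expectedCost (S : PowerSystem Ω) (x : MarketPlan Ω) : ℝ :=
  S.cI * x.pI + S.cF * x.pF
    + ∫ ω, (S.v * x.shed ω + S.cUp * x.up ω - S.cDown * x.down ω) ∂S.P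

/-- The constraints of the balancing stage, in every scenario, at demand `l`. -/
structure BalancingFeasible (S : PowerSystem Ω) (l : ℝ) (x : MarketPlan Ω) : Prop where
  measurable_up : Measurable x.up
  measurable_down : Measurable x.down
  measurable_dW : Measurable x.dW
  measurable_shed : Measurable x.shed
  balance : ∀ ω, x.shed ω + x.up ω - x.down ω + x.dW ω = 0
  down_mem : ∀ ω, 0 ≤ x.down ω ∧ x.down ω ≤ x.pF
  up_mem : ∀ ω, 0 ≤ x.up ω ∧ x.up ω ≤ S.capF - x.pF
  wind_mem : ∀ ω, 0 ≤ x.pW + x.dW ω ∧ x.pW + x.dW ω ≤ S.W ω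
  shed_mem : ∀ ω, 0 ≤ x.shed ω ∧ x.shed ω ≤ l

/-- The constraints of the stochastic two-stage market (`pW` is not constrained in sign). -/
structure StochasticFeasible (S : PowerSystem Ω) (l : ℝ) (x : MarketPlan Ω) : Prop where
  forward_balance : x.pF + x.pI + x.pW - l = 0
  pF_mem : 0 ≤ x.pF ∧ x.pF ≤ S.capF
  pI_mem : 0 ≤ x.pI ∧ x.pI ≤ S.capI
  balancing : S.BalancingFeasible l x

/-- `x` is a solution of the stochastic two-stage market: it minimizes the expected total
operating cost over all feasible plans. -/
def IsStochasticSolution (S : PowerSystem Ω) (l : ℝ) (x : MarketPlan Ω) : Prop :=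
  S.StochasticFeasible l x ∧
    ∀ y : MarketPlan Ω, S.StochasticFeasible l y → S.expectedCost x ≤ S.expectedCost y

/-- The constraints on `(xF, xI)` in the forward market clearing, when the amount `pW` of
stochastic production is dispatched. -/
def LowerFeasible (S : PowerSystem Ω) (l pW xF xI : ℝ) : Prop :=
  xF + xI + pW = l ∧ (0 ≤ xF ∧ xF ≤ S.capF) ∧ (0 ≤ xI ∧ xI ≤ S.capI)

/-- `(pF, pI)` minimizes the forward cost `cF xF + cI xI` for the given `pW`. -/
def IsLowerSolution (S : PowerSystem Ω) (l pW pF pI : ℝ) : Prop :=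
  S.LowerFeasible l pW pF pI ∧
    ∀ xF xI : ℝ, S.LowerFeasible l pW xF xI → S.cF * pF + S.cI * pI ≤ S.cF * xF + S.cI * xI

/-- The constraints of the bilevel problem (centralized dispatch of `pW`). -/
structure BilevelFeasible (S : PowerSystem Ω) (l : ℝ) (x : MarketPlan Ω) : Prop where
  pW_mem : 0 ≤ x.pW ∧ x.pW ≤ S.capW
  balancing : S.BalancingFeasible l x
  lower : S.IsLowerSolution l x.pW x.pF x.pI

/-- `x` is a solution of the bilevel problem. -/
def IsBilevelSolution (S : PowerSystem Ω) (l : ℝ) (x : MarketPlan Ω) : Prop :=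
  S.BilevelFeasible l x ∧
    ∀ y : MarketPlan Ω, S.BilevelFeasible l y → S.expectedCost x ≤ S.expectedCost y

/-- The merit order is violated when one of the two conventional technologies is dispatched
while a cheaper conventional technology is not used at capacity. -/
def ViolatesMeritOrder (S : PowerSystem Ω) (x : MarketPlan Ω) : Prop :=
  (S.cI < S.cF ∧ x.pI < S.capI ∧ 0 < x.pF) ∨ (S.cF < S.cI ∧ x.pF < S.capF ∧ 0 < x.pI)

end PowerSystem

/-!
Both markets reduce to one convex problem in two real variables: the demand `r = l - pI` left to
the other technologies and the flexible forward dispatch `p = pF`. For fixed `(r, p)` each scenario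
is balanced most cheaply by using stochastic production first, then flexible units, then load
shedding, and the resulting cost `recourse` is a maximum of affine functions of `(r, p)`. Its
expectation enters `dispatchCost`, a convex continuous function on a compact rectangle, so the
stochastic market has a solution. Every bilevel-feasible plan is feasible for the stochastic market.
Conversely, since `cI < cF`, a plan is optimal in the forward market as soon as `pI = capI` or
`pF = 0`. Hence it is enough to find an optimal `(r, p)` that respects the merit order and has
`0 ≤ r - p ≤ capW`.

The bounds on the stochastic dispatch `r - p` are harmless (`exists_isMinOn_meritOrder_mem_Icc`):
because `cDown ≤ cF ≤ cUp`, moving `p` into `[r - capW, r]` does not raise the cost if `pI = capI`,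
and if `pI < capI` and `p = 0` the inequality `r > capW` contradicts optimality, as `cI < cUp`.

The substantial case for the merit order is `l₂ ≤ l₁` (`exists_dispatchCost_zero_le`). Put
`x = min l₂ l`. The definition of `l₁` and the absence of an atom give
`F x * (cUp - cDown) ≤ cF - cDown`, which says that at `(x, 0)` raising `p` does not pay, and the
definition of `l₂` gives the first-order condition in `r`. By convexity `(x, 0)` is optimal among all
dispatches with `0 ≤ r ≤ l`. If `x < l - capI`, so that `(x, 0)` needs more than the inflexible
capacity, the segment from `(x, 0)` to an optimal dispatch meets the line `r = l - capI` in an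
optimal dispatch with `pI = capI`.
-/

namespace PowerSystem

variable {Ω : Type*} [MeasurableSpace Ω]

/-! ### Optimal recourse in one scenario -/

/-- The least cost of balancing the system in a scenario with stochastic production `w`, when
the inflexible units leave the demand `r` to be covered and the flexible units are dispatched
at `p`; it has this meaning for `0 ≤ r` and `0 ≤ p ≤ capF`. It is written as a
maximum of affine functions of `(r, p)`; the four pieces correspond to shedding load,
regulating up, regulating down, and switching the flexible units off. -/
noncomputable def recourse (S : PowerSystem Ω) (r p w : ℝ) : ℝ :=
  max (max (S.v * (r - w - S.capF) + S.cUp * (S.capF - p)) (S.cUp * (r - w - p)))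
    (max (S.cDown * (r - w - p)) (-(S.cDown * p)))

lemma recourse_le_iff (S : PowerSystem Ω) {r p w c : ℝ} :
    S.recourse r p w ≤ c ↔
      (S.v * (r - w - S.capF) + S.cUp * (S.capF - p) ≤ c ∧ S.cUp * (r - w - p) ≤ c) ∧
        S.cDown * (r - w - p) ≤ c ∧ -(S.cDown * p) ≤ c := by
  simp only [recourse, max_le_iff]

lemma recourse_bounds (S : PowerSystem Ω) (r p w : ℝ) :
    (S.v * (r - w - S.capF) + S.cUp * (S.capF - p) ≤ S.recourse r p w ∧
      S.cUp * (r - w - p) ≤ S.recourse r p w) ∧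
        S.cDown * (r - w - p) ≤ S.recourse r p w ∧ -(S.cDown * p) ≤ S.recourse r p w :=
  S.recourse_le_iff.1 le_rfl

lemma cUp_pos (S : PowerSystem Ω) : 0 < S.cUp := S.cF_pos.trans_le S.cF_le_cUp

lemma cDown_le_cUp (S : PowerSystem Ω) : S.cDown ≤ S.cUp := S.cDown_le_cF.trans S.cF_le_cUp

lemma continuous_recourse (S : PowerSystem Ω) :
    Continuous fun x : ℝ × ℝ × ℝ => S.recourse x.1 x.2.1 x.2.2 := by
  unfold recourse
  fun_prop

lemma abs_recourse_le (S : PowerSystem Ω) (r p : ℝ) {w : ℝ} (hw : 0 ≤ w) :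
    |S.recourse r p w| ≤ S.v * (|r| + |p| + S.capF) := by
  have h1 := S.cUp_lt_v
  have h2 := S.cUp_pos
  have h3 := S.cDown_le_cUp
  have h4 := S.cDown_nonneg
  have h5 := S.capF_pos
  have hr := abs_nonneg r
  have hr' := le_abs_self r
  have hp := abs_nonneg p
  have hp' := le_abs_self p
  have hp'' := neg_abs_le p
  have hd : r - w - p ≤ |r| + |p| + S.capF := by linarith
  have hs : 0 ≤ |r| + |p| + S.capF := by linarith
  have key : ∀ c, 0 ≤ c → c ≤ S.v → c * (r - w - p) ≤ S.v * (|r| + |p| + S.capF) :=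
    fun c hc hcv => (mul_le_mul_of_nonneg_left hd hc).trans (mul_le_mul_of_nonneg_right hcv hs)
  refine abs_le.2 ⟨?_, S.recourse_le_iff.2 ⟨⟨?_, key _ h2.le h1.le⟩, key _ h4 (by linarith), ?_⟩⟩
  · refine le_trans ?_ (S.recourse_bounds r p w).2.2
    nlinarith [mul_le_mul_of_nonneg_left hp' h4]
  · nlinarith [mul_le_mul_of_nonneg_left hp'' h2.le]
  · nlinarith [mul_le_mul_of_nonneg_left hp'' h4]

/-- No balancing decision costs less than `recourse`; here `q` is the stochastic production
that is used. -/
lemma recourse_le (S : PowerSystem Ω) {r p w s u d q : ℝ} (hbal : s + u - d = r - p - q)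
    (hq : q ≤ w) (hd : 0 ≤ d) (hdp : d ≤ p) (hu : 0 ≤ u) (hup : u ≤ S.capF - p) (hs : 0 ≤ s) :
    S.recourse r p w ≤ S.v * s + S.cUp * u - S.cDown * d := by
  have h1 := S.cUp_lt_v
  have h2 := S.cUp_pos
  have h3 := S.cDown_le_cUp
  have h4 := S.cDown_nonneg
  have e : r - w - p ≤ s + u - d := by linarith
  have vs : S.cUp * s ≤ S.v * s := mul_le_mul_of_nonneg_right h1.le hs
  have ud : S.cDown * d ≤ S.cUp * d := mul_le_mul_of_nonneg_right h3 hd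
  have us : S.cDown * s ≤ S.cUp * s := mul_le_mul_of_nonneg_right h3 hs
  have uu : S.cDown * u ≤ S.cUp * u := mul_le_mul_of_nonneg_right h3 hu
  have e1 := mul_le_mul_of_nonneg_left e h2.le
  have e2 := mul_le_mul_of_nonneg_left e h4
  have e3 := mul_le_mul_of_nonneg_left e (h2.trans h1).le
  have e4 : (S.v - S.cUp) * u ≤ (S.v - S.cUp) * (S.capF - p) :=
    mul_le_mul_of_nonneg_left hup (sub_nonneg.2 h1.le)
  have e5 : S.cUp * d ≤ S.v * d := mul_le_mul_of_nonneg_right h1.le hd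
  have e6 := mul_le_mul_of_nonneg_left hdp h4
  have e7 := mul_nonneg h4 hs
  have e8 := mul_nonneg h4 hu
  refine S.recourse_le_iff.2 ⟨⟨?_, ?_⟩, ?_, ?_⟩ <;> linarith

/-- The merit-order balancing decision (stochastic production first, then flexible units, then
load shedding) costs at most `recourse`. -/
lemma le_recourse (S : PowerSystem Ω) {r p w : ℝ} (hp : 0 ≤ p) (hpc : p ≤ S.capF) :
    S.v * (max (r - w) 0 - min S.capF (max (r - w) 0))
        + S.cUp * max (min S.capF (max (r - w) 0) - p) 0
        - S.cDown * max (p - min S.capF (max (r - w) 0)) 0 ≤ S.recourse r p w := by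
  obtain ⟨⟨hA, hB⟩, hC, hE⟩ := S.recourse_bounds r p w
  rcases le_total (r - w) 0 with h | h
  · rw [max_eq_right h, min_eq_right S.capF_pos.le, max_eq_right (by linarith : 0 - p ≤ 0),
      max_eq_left (by linarith : 0 ≤ p - 0)]
    linarith
  · rw [max_eq_left h]
    rcases le_total S.capF (r - w) with h' | h'
    · rw [min_eq_left h', max_eq_left (by linarith : 0 ≤ S.capF - p),
        max_eq_right (by linarith : p - S.capF ≤ 0)]
      linarith
    · rw [min_eq_right h']
      rcases le_total p (r - w) with h'' | h''
      · rw [max_eq_left (by linarith : 0 ≤ r - w - p), max_eq_right (by linarith : p - (r - w) ≤ 0)]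
        linarith
      · rw [max_eq_right (by linarith : r - w - p ≤ 0), max_eq_left (by linarith : 0 ≤ p - (r - w))]
        linarith

lemma recourse_convex (S : PowerSystem Ω) {r₁ p₁ r₂ p₂ t : ℝ} (w : ℝ) (ht : 0 ≤ t) (ht1 : t ≤ 1) :
    S.recourse ((1 - t) * r₁ + t * r₂) ((1 - t) * p₁ + t * p₂) w
      ≤ (1 - t) * S.recourse r₁ p₁ w + t * S.recourse r₂ p₂ w := by
  obtain ⟨⟨hA, hB⟩, hC, hE⟩ := S.recourse_bounds r₁ p₁ w
  obtain ⟨⟨hA', hB'⟩, hC', hE'⟩ := S.recourse_bounds r₂ p₂ w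
  have ht' := sub_nonneg.2 ht1
  have key : ∀ {a b : ℝ}, a ≤ S.recourse r₁ p₁ w → b ≤ S.recourse r₂ p₂ w →
      (1 - t) * a + t * b ≤ (1 - t) * S.recourse r₁ p₁ w + t * S.recourse r₂ p₂ w :=
    fun ha hb => add_le_add (mul_le_mul_of_nonneg_left ha ht') (mul_le_mul_of_nonneg_left hb ht)
  refine S.recourse_le_iff.2 ⟨⟨?_, ?_⟩, ?_, ?_⟩
  · linarith [key hA hA']
  · linarith [key hB hB']
  · linarith [key hC hC']
  · linarith [key hE hE']

/-- Dispatching more flexible units than the demand left to them never pays. -/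
lemma recourse_self_le (S : PowerSystem Ω) {r p w : ℝ} (hw : 0 ≤ w) (hrp : r ≤ p)
    (hp : p ≤ S.capF) :
    S.cF * r + S.recourse r r w ≤ S.cF * p + S.recourse r p w := by
  obtain ⟨-, hC, hE⟩ := S.recourse_bounds r p w
  have h1 := S.cUp_lt_v
  have h3 := S.cDown_le_cUp
  have h4 := S.cDown_nonneg
  have e1 : S.cDown * (p - r) ≤ S.cF * (p - r) :=
    mul_le_mul_of_nonneg_right S.cDown_le_cF (by linarith)
  have e2 : S.cDown * w ≤ S.cUp * w := mul_le_mul_of_nonneg_right h3 hw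
  have e3 : 0 ≤ (S.v - S.cUp) * (S.capF - r + w) :=
    mul_nonneg (by linarith) (by linarith)
  have : S.recourse r r w ≤ S.cF * p + S.recourse r p w - S.cF * r :=
    S.recourse_le_iff.2 ⟨⟨by linarith, by linarith⟩, by linarith, by linarith⟩
  linarith

/-- Flexible dispatch below the residual demand that remains even at full stochastic production
can be raised to that level without loss. -/
lemma recourse_raise_le (S : PowerSystem Ω) {r p p' w : ℝ} (hp' : 0 ≤ p') (hpp : p ≤ p')
    (hw : p' ≤ r - w) :
    S.cF * p' + S.recourse r p' w ≤ S.cF * p + S.recourse r p w := by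
  obtain ⟨⟨hA, hB⟩, -, -⟩ := S.recourse_bounds r p w
  have h3 := S.cDown_le_cUp
  have h4 := S.cDown_nonneg
  have e1 : S.cF * (p' - p) ≤ S.cUp * (p' - p) :=
    mul_le_mul_of_nonneg_right S.cF_le_cUp (by linarith)
  have e2 : S.cDown * (r - w - p') ≤ S.cUp * (r - w - p') :=
    mul_le_mul_of_nonneg_right h3 (by linarith)
  have e3 : 0 ≤ S.cDown * (r - w - p') := mul_nonneg h4 (by linarith)
  have e4 := mul_nonneg h4 hp'
  have : S.recourse r p' w ≤ S.cF * p + S.recourse r p w - S.cF * p' :=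
    S.recourse_le_iff.2 ⟨⟨by linarith, by linarith⟩, by linarith, by linarith⟩
  linarith

/-- Without flexible dispatch, residual demand above the stochastic production costs at least
`cUp` per unit. -/
lemma recourse_zero_add_le (S : PowerSystem Ω) {r r' w : ℝ} (hw : w ≤ r') (hr : r' ≤ r) :
    S.recourse r' 0 w + S.cUp * (r - r') ≤ S.recourse r 0 w := by
  obtain ⟨⟨hA, hB⟩, -, -⟩ := S.recourse_bounds r 0 w
  have e1 : S.cUp * (r - r') ≤ S.v * (r - r') :=
    mul_le_mul_of_nonneg_right S.cUp_lt_v.le (by linarith)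
  have e2 : S.cDown * (r' - w) ≤ S.cUp * (r' - w) :=
    mul_le_mul_of_nonneg_right S.cDown_le_cUp (by linarith)
  have e3 : 0 ≤ S.cDown * (r' - w) := mul_nonneg S.cDown_nonneg (by linarith)
  have : S.recourse r' 0 w ≤ S.recourse r 0 w - S.cUp * (r - r') :=
    S.recourse_le_iff.2 ⟨⟨by linarith, by linarith⟩, by linarith, by linarith⟩
  linarith

/-- With free regulation the flexible forward dispatch does not matter. -/
lemma recourse_zero_le_of_eq (S : PowerSystem Ω) (h : S.cF = S.cUp) (h' : S.cUp = S.cDown)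
    (r p w : ℝ) :
    S.recourse r 0 w ≤ S.cF * p + S.recourse r p w := by
  obtain ⟨⟨hA, hB⟩, hC, hE⟩ := S.recourse_bounds r p w
  rw [← h', ← h] at hC hE
  rw [← h] at hA hB
  refine S.recourse_le_iff.2 ?_
  rw [← h', ← h]
  exact ⟨⟨by linarith, by linarith⟩, by linarith, by linarith⟩

/-- A subgradient inequality at `(x, 0)`. The two flags say whether the slopes of load shedding
(`a = 1`) and of upward regulation (`b = 1`) are active, and at a kink either value is allowed. -/
lemma recourse_subgradient (S : PowerSystem Ω) {x r p w a b : ℝ}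
    (ha : a = 1 ∧ w ≤ x - S.capF ∨ a = 0 ∧ x - S.capF ≤ w)
    (hb : b = 1 ∧ w ≤ x ∨ b = 0 ∧ x ≤ w) (hab : a ≤ b) :
    S.recourse x 0 w + ((S.v - S.cUp) * a + S.cUp * b) * (r - x)
      - (S.cDown + (S.cUp - S.cDown) * b) * p ≤ S.recourse r p w := by
  obtain ⟨⟨hA, hB⟩, hC, hE⟩ := S.recourse_bounds r p w
  have h1 := S.cUp_lt_v
  have h2 := S.cUp_pos
  have h3 := S.cDown_le_cUp
  have h4 := S.cDown_nonneg
  have h5 := S.capF_pos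
  rcases hb with ⟨rfl, hb⟩ | ⟨rfl, hb⟩
  · have e2 : S.cDown * (x - w) ≤ S.cUp * (x - w) :=
      mul_le_mul_of_nonneg_right h3 (by linarith)
    have e3 : 0 ≤ S.cDown * (x - w) := mul_nonneg h4 (by linarith)
    rcases ha with ⟨rfl, ha⟩ | ⟨rfl, ha⟩
    · have e1 : 0 ≤ (S.v - S.cUp) * (x - w - S.capF) := mul_nonneg (by linarith) (by linarith)
      have : S.recourse x 0 w ≤ S.v * (x - w - S.capF) + S.cUp * S.capF :=
        S.recourse_le_iff.2 ⟨⟨by linarith, by linarith⟩, by linarith, by linarith⟩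
      linarith
    · have e1 : 0 ≤ (S.v - S.cUp) * (S.capF - (x - w)) := mul_nonneg (by linarith) (by linarith)
      have : S.recourse x 0 w ≤ S.cUp * (x - w) :=
        S.recourse_le_iff.2 ⟨⟨by linarith, by linarith⟩, by linarith, by linarith⟩
      linarith
  · have ha0 : a = 0 := by
      rcases ha with ⟨rfl, -⟩ | ⟨rfl, -⟩
      · linarith
      · rfl
    subst ha0
    have e1 : 0 ≤ (S.v - S.cUp) * (S.capF - (x - w)) := mul_nonneg (by linarith) (by linarith)
    have e2 : 0 ≤ S.cUp * (w - x) := mul_nonneg h2.le (by linarith)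
    have e3 : 0 ≤ S.cDown * (w - x) := mul_nonneg h4 (by linarith)
    have : S.recourse x 0 w ≤ 0 :=
      S.recourse_le_iff.2 ⟨⟨by linarith, by linarith⟩, by linarith, by linarith⟩
    linarith

/-! ### The expected cost as a function of the forward dispatch -/

/-- The least expected cost at demand `l` when `l - r` is dispatched from the inflexible units
and `p` from the flexible ones. -/
noncomputable def dispatchCost (S : PowerSystem Ω) (l r p : ℝ) : ℝ :=
  S.cI * (l - r) + S.cF * p + ∫ ω, S.recourse r p (S.W ω) ∂S.P

lemma measurable_recourse (S : PowerSystem Ω) (r p : ℝ) :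
    Measurable fun ω => S.recourse r p (S.W ω) := by
  have : Continuous fun w => S.recourse r p w :=
    S.continuous_recourse.comp (by fun_prop : Continuous fun w : ℝ => (r, p, w))
  exact this.measurable.comp S.measurable_W

lemma integrable_recourse (S : PowerSystem Ω) (r p : ℝ) :
    Integrable (fun ω => S.recourse r p (S.W ω)) S.P := by
  have := S.isProbabilityMeasure
  exact Integrable.of_bound (S.measurable_recourse r p).aestronglyMeasurable _
    (ae_of_all _ fun ω => S.abs_recourse_le r p (S.W_nonneg ω))

/-- Pointwise comparison of the costs of two forward dispatches, where `c` is an amount by which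
one falls short of the other. -/
lemma dispatchCost_le_of_forall (S : PowerSystem Ω) {l r p r' p' c : ℝ}
    (h : ∀ ω, S.cI * (l - r) + S.cF * p + S.recourse r p (S.W ω) + c
      ≤ S.cI * (l - r') + S.cF * p' + S.recourse r' p' (S.W ω)) :
    S.dispatchCost l r p + c ≤ S.dispatchCost l r' p' := by
  have := S.isProbabilityMeasure
  have hm := integral_mono (μ := S.P)
    ((S.integrable_recourse r p).add
      (integrable_const (S.cI * (l - r) + S.cF * p + c - (S.cI * (l - r') + S.cF * p'))))
    (S.integrable_recourse r' p') (fun ω => by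
      have := h ω
      simp only [Pi.add_apply]
      linarith)
  simp only [Pi.add_apply] at hm
  rw [integral_add (S.integrable_recourse r p) (integrable_const _), integral_const] at hm
  simp only [probReal_univ, one_smul] at hm
  unfold dispatchCost
  linarith

lemma continuousOn_dispatchCost (S : PowerSystem Ω) (l : ℝ) {s : Set (ℝ × ℝ)} (hs : IsCompact s) :
    ContinuousOn (fun x : ℝ × ℝ => S.dispatchCost l x.1 x.2) s := by
  have := S.isProbabilityMeasure
  obtain ⟨C, hC⟩ := (hs.image
    (by fun_prop : Continuous fun x : ℝ × ℝ => S.v * (|x.1| + |x.2| + S.capF))).bddAbove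
  unfold dispatchCost
  refine ContinuousOn.add (by fun_prop) ?_
  refine continuousOn_of_dominated (bound := fun _ => C)
    (fun x _ => (S.measurable_recourse _ _).aestronglyMeasurable)
    (fun x hx => ae_of_all _ fun ω => (S.abs_recourse_le _ _ (S.W_nonneg ω)).trans
      (hC ⟨x, hx, rfl⟩)) (integrable_const C) (ae_of_all _ fun ω => ?_)
  exact (S.continuous_recourse.comp
    (by fun_prop : Continuous fun x : ℝ × ℝ => (x.1, x.2, S.W ω))).continuousOn

lemma dispatchCost_convex (S : PowerSystem Ω) (l : ℝ) {r₁ p₁ r₂ p₂ t : ℝ} (ht : 0 ≤ t)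
    (ht1 : t ≤ 1) :
    S.dispatchCost l ((1 - t) * r₁ + t * r₂) ((1 - t) * p₁ + t * p₂)
      ≤ (1 - t) * S.dispatchCost l r₁ p₁ + t * S.dispatchCost l r₂ p₂ := by
  have h1 := (S.integrable_recourse r₁ p₁).const_mul (1 - t)
  have h2 := (S.integrable_recourse r₂ p₂).const_mul t
  have hm := integral_mono (S.integrable_recourse ((1 - t) * r₁ + t * r₂) ((1 - t) * p₁ + t * p₂))
    (h1.add h2) (fun ω => S.recourse_convex (S.W ω) ht ht1)
  simp only [Pi.add_apply] at hm
  rw [integral_add h1 h2, integral_const_mul, integral_const_mul] at hm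
  unfold dispatchCost
  linarith

/-- The forward dispatches that admit a feasible plan: `l - r` is an admissible inflexible
dispatch, and the demand `r` left over is nonnegative. -/
def dispatchSet (S : PowerSystem Ω) (l : ℝ) : Set (ℝ × ℝ) :=
  Set.Icc (max 0 (l - S.capI)) l ×ˢ Set.Icc 0 S.capF

lemma mem_dispatchSet (S : PowerSystem Ω) {l r p : ℝ} :
    (r, p) ∈ S.dispatchSet l ↔
      ((0 ≤ r ∧ l - S.capI ≤ r) ∧ r ≤ l) ∧ 0 ≤ p ∧ p ≤ S.capF := by
  simp only [dispatchSet, Set.mem_prod, Set.mem_Icc, max_le_iff]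

lemma exists_isMinOn_dispatchCost (S : PowerSystem Ω) {l : ℝ} (hl : 0 ≤ l) :
    ∃ r p, (r, p) ∈ S.dispatchSet l ∧
      ∀ r' p', (r', p') ∈ S.dispatchSet l → S.dispatchCost l r p ≤ S.dispatchCost l r' p' := by
  have hc : IsCompact (S.dispatchSet l) := isCompact_Icc.prod isCompact_Icc
  have hne : (S.dispatchSet l).Nonempty :=
    ⟨(l, 0), S.mem_dispatchSet.2 ⟨⟨⟨hl, by linarith [S.capI_pos]⟩, le_rfl⟩, le_rfl, S.capF_pos.le⟩⟩
  obtain ⟨⟨r, p⟩, hx, hmin⟩ := hc.exists_isMinOn hne (S.continuousOn_dispatchCost l hc)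
  exact ⟨r, p, hx, fun r' p' h => hmin h⟩

lemma StochasticFeasible.mem_dispatchSet {S : PowerSystem Ω} {l : ℝ} {x : MarketPlan Ω}
    (h : S.StochasticFeasible l x) : (l - x.pI, x.pF) ∈ S.dispatchSet l := by
  have := S.isProbabilityMeasure
  obtain ⟨ω⟩ := S.P.nonempty_of_neZero
  have h1 := h.forward_balance
  have h2 := h.balancing.balance ω
  have h3 := h.balancing.down_mem ω
  have h4 := h.balancing.up_mem ω
  have h5 := h.balancing.wind_mem ω
  have h6 := h.balancing.shed_mem ω
  exact S.mem_dispatchSet.2 ⟨⟨⟨by linarith, by linarith [h.pI_mem.2]⟩, by linarith [h.pI_mem.1]⟩,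
    h.pF_mem⟩

lemma BalancingFeasible.integrable {S : PowerSystem Ω} {l : ℝ} {x : MarketPlan Ω}
    (h : S.BalancingFeasible l x) :
    Integrable (fun ω => S.v * x.shed ω + S.cUp * x.up ω - S.cDown * x.down ω) S.P := by
  have := S.isProbabilityMeasure
  have bdd : ∀ {f : Ω → ℝ} {c : ℝ}, Measurable f → (∀ ω, 0 ≤ f ω ∧ f ω ≤ c) → Integrable f S.P :=
    fun {f c} hf hc => Integrable.of_bound hf.aestronglyMeasurable c
      (ae_of_all _ fun ω => by rw [Real.norm_of_nonneg (hc ω).1]; exact (hc ω).2)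
  exact (((bdd h.measurable_shed h.shed_mem).const_mul _).add
      ((bdd h.measurable_up h.up_mem).const_mul _)).sub
      ((bdd h.measurable_down h.down_mem).const_mul _)

lemma StochasticFeasible.dispatchCost_le {S : PowerSystem Ω} {l : ℝ} {x : MarketPlan Ω}
    (h : S.StochasticFeasible l x) : S.dispatchCost l (l - x.pI) x.pF ≤ S.expectedCost x := by
  have hb := h.balancing
  have hm := integral_mono (S.integrable_recourse (l - x.pI) x.pF) hb.integrable (fun ω => by
    refine S.recourse_le (q := x.pW + x.dW ω) ?_ (hb.wind_mem ω).2 (hb.down_mem ω).1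
      (hb.down_mem ω).2 (hb.up_mem ω).1 (hb.up_mem ω).2 (hb.shed_mem ω).1
    linarith [hb.balance ω, h.forward_balance])
  unfold dispatchCost expectedCost
  linarith

/-- The plan with inflexible dispatch `l - r` and flexible dispatch `p` that balances every
scenario in merit order. -/
noncomputable def optimalPlan (S : PowerSystem Ω) (l r p : ℝ) : MarketPlan Ω where
  pF := p
  pI := l - r
  pW := r - p
  up ω := max (min S.capF (max (r - S.W ω) 0) - p) 0
  down ω := max (p - min S.capF (max (r - S.W ω) 0)) 0
  dW ω := p - max (r - S.W ω) 0
  shed ω := max (r - S.W ω) 0 - min S.capF (max (r - S.W ω) 0)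

lemma stochasticFeasible_optimalPlan (S : PowerSystem Ω) {l r p : ℝ}
    (h : (r, p) ∈ S.dispatchSet l) : S.StochasticFeasible l (S.optimalPlan l r p) := by
  obtain ⟨⟨⟨hr, hrI⟩, hrl⟩, hp, hpF⟩ := S.mem_dispatchSet.1 h
  have hW := S.measurable_W
  have hF := S.capF_pos
  have hW0 := S.W_nonneg
  refine ⟨by simp only [optimalPlan]; ring, ⟨hp, hpF⟩,
    ⟨by simp only [optimalPlan]; linarith, by simp only [optimalPlan]; linarith⟩,
    by simp only [optimalPlan]; fun_prop, by simp only [optimalPlan]; fun_prop,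
    by simp only [optimalPlan]; fun_prop, by simp only [optimalPlan]; fun_prop,
    fun ω => ?_, fun ω => ?_, fun ω => ?_, fun ω => ?_, fun ω => ?_⟩
  all_goals
    simp only [optimalPlan]
    have hω := hW0 ω
    have hD : 0 ≤ max (r - S.W ω) 0 := le_max_right _ _
    have hf : 0 ≤ min S.capF (max (r - S.W ω) 0) := le_min hF.le hD
    have hf' : min S.capF (max (r - S.W ω) 0) ≤ S.capF := min_le_left _ _
    have hf'' : min S.capF (max (r - S.W ω) 0) ≤ max (r - S.W ω) 0 := min_le_right _ _
    have hDr : max (r - S.W ω) 0 ≤ r := max_le (by linarith) hr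
    have hDW : r - S.W ω ≤ max (r - S.W ω) 0 := le_max_left _ _
  · rcases le_total p (min S.capF (max (r - S.W ω) 0)) with h' | h'
    · rw [max_eq_left (sub_nonneg.2 h'), max_eq_right (sub_nonpos.2 h')]
      ring
    · rw [max_eq_right (sub_nonpos.2 h'), max_eq_left (sub_nonneg.2 h')]
      ring
  · exact ⟨le_max_right _ _, max_le (by linarith) hp⟩
  · exact ⟨le_max_right _ _, max_le (by linarith) (by linarith)⟩
  · exact ⟨by linarith, by linarith⟩
  · exact ⟨by linarith, by linarith⟩

lemma expectedCost_optimalPlan (S : PowerSystem Ω) {l r p : ℝ}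
    (h : (r, p) ∈ S.dispatchSet l) :
    S.expectedCost (S.optimalPlan l r p) = S.dispatchCost l r p := by
  obtain ⟨-, hp, hpF⟩ := S.mem_dispatchSet.1 h
  have hfeas := S.stochasticFeasible_optimalPlan h
  refine le_antisymm ?_ ?_
  · have hm := integral_mono hfeas.balancing.integrable (S.integrable_recourse r p)
      (fun ω => S.le_recourse hp hpF)
    unfold dispatchCost expectedCost
    simp only [optimalPlan] at hm ⊢
    linarith
  · have := hfeas.dispatchCost_le
    simpa only [optimalPlan, sub_sub_cancel] using this

/-! ### One-sided limits of the distribution function -/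

lemma F_mono (S : PowerSystem Ω) : Monotone S.F := fun _ _ h => by
  have := S.isProbabilityMeasure
  exact ENNReal.toReal_mono (measure_ne_top _ _) (measure_mono fun ω hω => le_trans hω h)

lemma F_of_capW_le (S : PowerSystem Ω) {x : ℝ} (hx : S.capW ≤ x) : S.F x = 1 := by
  have := S.isProbabilityMeasure
  have h : {ω | S.W ω ≤ x} = Set.univ := Set.eq_univ_of_forall fun ω => (S.W_le ω).trans hx
  simp [F, h]

lemma tendsto_F_right (S : PowerSystem Ω) (x : ℝ) :
    Filter.Tendsto (fun n : ℕ => S.F (x + 1 / ((n : ℝ) + 1))) Filter.atTop (nhds (S.F x)) := by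
  have := S.isProbabilityMeasure
  have h0 := tendsto_one_div_add_atTop_nhds_zero_nat (𝕜 := ℝ)
  have hset : {ω | S.W ω ≤ x} = ⋂ n : ℕ, {ω | S.W ω ≤ x + 1 / ((n : ℝ) + 1)} := by
    ext ω
    simp only [Set.mem_ofPred_eq, Set.mem_iInter]
    refine ⟨fun h n => h.trans (le_add_of_nonneg_right (by positivity)), fun h => ?_⟩
    have := ge_of_tendsto' (h0.const_add x) h
    simpa using this
  unfold F
  rw [hset]
  refine (ENNReal.tendsto_toReal (measure_ne_top _ _)).comp
    (tendsto_measure_iInter_atTop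
      (fun n => (measurableSet_le S.measurable_W measurable_const).nullMeasurableSet)
      (fun m n hmn ω (hω : S.W ω ≤ _) => show S.W ω ≤ _ from ?_) ⟨0, measure_ne_top _ _⟩)
  have := Nat.one_div_le_one_div (α := ℝ) hmn
  linarith

lemma tendsto_F_left (S : PowerSystem Ω) (x : ℝ) :
    Filter.Tendsto (fun n : ℕ => S.F (x - 1 / ((n : ℝ) + 1))) Filter.atTop
      (nhds (S.P.real {ω | S.W ω < x})) := by
  have := S.isProbabilityMeasure
  have h0 := tendsto_one_div_add_atTop_nhds_zero_nat (𝕜 := ℝ)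
  have hset : {ω | S.W ω < x} = ⋃ n : ℕ, {ω | S.W ω ≤ x - 1 / ((n : ℝ) + 1)} := by
    ext ω
    simp only [Set.mem_ofPred_eq, Set.mem_iUnion]
    constructor
    · intro h
      obtain ⟨n, hn⟩ := exists_nat_one_div_lt (sub_pos.2 h)
      exact ⟨n, by linarith⟩
    · rintro ⟨n, hn⟩
      have : 0 < 1 / ((n : ℝ) + 1) := by positivity
      linarith
  unfold F Measure.real
  rw [hset]
  refine (ENNReal.tendsto_toReal (measure_ne_top _ _)).comp
    (tendsto_measure_iUnion_atTop (fun m n hmn ω (hω : S.W ω ≤ _) => show S.W ω ≤ _ from ?_))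
  have := Nat.one_div_le_one_div (α := ℝ) hmn
  linarith

/-! ### Global optimality of a dispatch without flexible units -/

/-- The integrated subgradient inequality at `(x, 0)`, with the slopes of load shedding and of
upward regulation active on the events `A` and `B`. -/
lemma dispatchCost_subgradient (S : PowerSystem Ω) (l r p : ℝ) {x : ℝ} {A B : Set Ω}
    (hA : MeasurableSet A) (hB : MeasurableSet B) (hAB : A ⊆ B)
    (hAin : ∀ ω ∈ A, S.W ω ≤ x - S.capF) (hAout : ∀ ω ∉ A, x - S.capF ≤ S.W ω)
    (hBin : ∀ ω ∈ B, S.W ω ≤ x) (hBout : ∀ ω ∉ B, x ≤ S.W ω) :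
    S.dispatchCost l x 0 + ((S.v - S.cUp) * S.P.real A + S.cUp * S.P.real B - S.cI) * (r - x)
      + (S.cF - S.cDown - (S.cUp - S.cDown) * S.P.real B) * p ≤ S.dispatchCost l r p := by
  have := S.isProbabilityMeasure
  have iA : Integrable (A.indicator fun _ => (1 : ℝ)) S.P := (integrable_const 1).indicator hA
  have iB : Integrable (B.indicator fun _ => (1 : ℝ)) S.P := (integrable_const 1).indicator hB
  have i1 := iA.const_mul ((S.v - S.cUp) * (r - x))
  have i2 := iB.const_mul (S.cUp * (r - x) - (S.cUp - S.cDown) * p)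
  have i3 := (S.integrable_recourse x 0).add (integrable_const (μ := S.P) (-(S.cDown * p)))
  have hm := integral_mono ((i3.add i1).add i2) (S.integrable_recourse r p) (fun ω => by
    have h := S.recourse_subgradient (x := x) (r := r) (p := p) (w := S.W ω)
      (a := A.indicator (fun _ => (1 : ℝ)) ω) (b := B.indicator (fun _ => (1 : ℝ)) ω)
      (by by_cases h : ω ∈ A
          · exact Or.inl ⟨by simp [h], hAin ω h⟩
          · exact Or.inr ⟨by simp [h], hAout ω h⟩)
      (by by_cases h : ω ∈ B
          · exact Or.inl ⟨by simp [h], hBin ω h⟩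
          · exact Or.inr ⟨by simp [h], hBout ω h⟩)
      (Set.indicator_le_indicator_of_subset hAB (fun _ => zero_le_one) ω)
    simp only [Pi.add_apply]
    linarith)
  rw [integral_add' (i3.add i1) i2, integral_add' i3 i1,
    integral_add' (S.integrable_recourse x 0) (integrable_const _), integral_const_mul,
    integral_const_mul, integral_indicator_const _ hA, integral_indicator_const _ hB,
    integral_const] at hm
  simp only [probReal_univ, smul_eq_mul, mul_one, one_mul] at hm
  unfold dispatchCost
  linarith

/-- First-order conditions for `(x, 0)`: `hp` says that flexible dispatch does not pay, `hright`
and `hleft` are the conditions in the direction of larger and smaller `r`. -/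
lemma dispatchCost_zero_le (S : PowerSystem Ω) (l : ℝ) {x r p : ℝ} (hp0 : 0 ≤ p)
    (hp : S.F x * (S.cUp - S.cDown) ≤ S.cF - S.cDown)
    (hright : x < r → S.cI ≤ (S.v - S.cUp) * S.F (x - S.capF) + S.cUp * S.F x)
    (hleft : r < x → (S.v - S.cUp) * S.P.real {ω | S.W ω < x - S.capF}
      + S.cUp * S.P.real {ω | S.W ω < x} ≤ S.cI) :
    S.dispatchCost l x 0 ≤ S.dispatchCost l r p := by
  have := S.isProbabilityMeasure
  have hF := S.capF_pos
  have hdu := sub_nonneg.2 S.cDown_le_cUp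
  rcases lt_or_ge r x with hrx | hrx
  · have h := S.dispatchCost_subgradient l r p (x := x) (A := {ω | S.W ω < x - S.capF})
      (B := {ω | S.W ω < x})
      (measurableSet_lt S.measurable_W measurable_const)
      (measurableSet_lt S.measurable_W measurable_const)
      (fun ω (hω : S.W ω < _) => show S.W ω < _ by linarith) (fun ω hω => le_of_lt hω)
      (fun ω hω => not_lt.1 hω) (fun ω hω => le_of_lt hω) (fun ω hω => not_lt.1 hω)
    have hle : S.P.real {ω | S.W ω < x} ≤ S.F x :=
      measureReal_mono fun ω (hω : S.W ω < x) => show S.W ω ≤ x from hω.le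
    have e1 := mul_nonneg_of_nonpos_of_nonpos (sub_nonpos.2 (hleft hrx)) (sub_nonpos.2 hrx.le)
    have e2 := mul_le_mul_of_nonneg_right hle hdu
    have e3 : 0 ≤ (S.cF - S.cDown
        - (S.cUp - S.cDown) * S.P.real {ω | S.W ω < x}) * p :=
      mul_nonneg (by linarith) hp0
    linarith
  · have h := S.dispatchCost_subgradient l r p (x := x) (A := {ω | S.W ω ≤ x - S.capF})
      (B := {ω | S.W ω ≤ x})
      (measurableSet_le S.measurable_W measurable_const)
      (measurableSet_le S.measurable_W measurable_const)
      (fun ω (hω : S.W ω ≤ _) => show S.W ω ≤ _ by linarith) (fun ω hω => hω)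
      (fun ω hω => le_of_not_ge hω) (fun ω hω => hω) (fun ω hω => le_of_not_ge hω)
    change S.dispatchCost l x 0 + ((S.v - S.cUp) * S.F (x - S.capF) + S.cUp * S.F x - S.cI)
      * (r - x) + (S.cF - S.cDown - (S.cUp - S.cDown) * S.F x) * p ≤ S.dispatchCost l r p at h
    have e1 : 0 ≤ ((S.v - S.cUp) * S.F (x - S.capF) + S.cUp * S.F x - S.cI) * (r - x) := by
      rcases hrx.eq_or_lt with rfl | hlt
      · simp
      · exact mul_nonneg (sub_nonneg.2 (hright hlt)) (sub_nonneg.2 hrx)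
    have e3 : 0 ≤ (S.cF - S.cDown - (S.cUp - S.cDown) * S.F x) * p :=
      mul_nonneg (by linarith) hp0
    linarith

/-- The infimum defining `l₂` is attained by a real number. -/
lemma exists_l₂_eq (S : PowerSystem Ω) (hc : S.cI < S.cF) :
    ∃ x : ℝ, S.l₂ = x ∧ 0 ≤ x ∧
      S.cI ≤ (S.v - S.cUp) * S.F (x - S.capF) + S.cUp * S.F x ∧
      ∀ y, 0 ≤ y → y < x → (S.v - S.cUp) * S.F (y - S.capF) + S.cUp * S.F y < S.cI := by
  have hv := sub_nonneg.2 S.cUp_lt_v.le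
  set T : Set ℝ := {x : ℝ | 0 ≤ x ∧ S.cI ≤ (S.v - S.cUp) * S.F (x - S.capF) + S.cUp * S.F x}
    with hT
  have hne : T.Nonempty := by
    refine ⟨S.capW, S.capW_pos.le, ?_⟩
    have : 0 ≤ (S.v - S.cUp) * S.F (S.capW - S.capF) := mul_nonneg hv ENNReal.toReal_nonneg
    rw [S.F_of_capW_le le_rfl]
    linarith [S.cF_le_cUp]
  have hbdd : BddBelow T := ⟨0, fun x hx => hx.1⟩
  have hx0 : 0 ≤ sInf T := le_csInf hne fun x hx => hx.1
  have hmem : S.cI ≤ (S.v - S.cUp) * S.F (sInf T - S.capF) + S.cUp * S.F (sInf T) := by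
    have hlim := ((S.tendsto_F_right (sInf T - S.capF)).const_mul (S.v - S.cUp)).add
      ((S.tendsto_F_right (sInf T)).const_mul S.cUp)
    refine ge_of_tendsto' hlim fun n => ?_
    obtain ⟨y, hy, hlt⟩ := exists_lt_of_csInf_lt hne
      (lt_add_of_pos_right (sInf T) (by positivity : 0 < 1 / ((n : ℝ) + 1)))
    have e1 := mul_le_mul_of_nonneg_left (S.F_mono
      (by linarith : y - S.capF ≤ sInf T - S.capF + 1 / ((n : ℝ) + 1))) hv
    have e2 := mul_le_mul_of_nonneg_left (S.F_mono hlt.le) S.cUp_pos.le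
    linarith [hy.2]
  refine ⟨sInf T, le_antisymm (sInf_le ⟨_, ⟨hx0, hmem⟩, rfl⟩) (le_sInf ?_), hx0, hmem,
    fun y hy hlt => ?_⟩
  · rintro _ ⟨y, hy, rfl⟩
    exact EReal.coe_le_coe_iff.2 (csInf_le hbdd hy)
  · by_contra! h
    exact notMem_of_lt_csInf hlt hbdd ⟨hy, h⟩

lemma F_mul_le_of_lt_l₁ (S : PowerSystem Ω) {x : ℝ} (hx : (x : EReal) < S.l₁) :
    S.F x * (S.cUp - S.cDown) ≤ S.cF - S.cDown := by
  have h : S.F x < (S.cF - S.cDown) / (S.cUp - S.cDown) := by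
    by_contra! h
    exact absurd hx (not_lt.2 (sInf_le ⟨x, h, rfl⟩))
  rcases S.cDown_le_cUp.eq_or_lt with he | hlt
  · rw [he, sub_self, mul_zero, ← he]
    linarith [S.cDown_le_cF]
  · exact ((lt_div_iff₀ (sub_pos.2 hlt)).1 h).le

/-- If `l₂ ≤ l₁`, without an atom at the common value in case of equality, then some dispatch
without flexible units is optimal among all dispatches with `0 ≤ r ≤ l`, the capacity of the
inflexible units being disregarded. -/
lemma exists_dispatchCost_zero_le (S : PowerSystem Ω) (hc : S.cI < S.cF) {l : ℝ} (hl : 0 ≤ l)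
    (h : S.l₂ ≤ S.l₁) (hatom : S.l₁ = S.l₂ → S.P {ω | (S.W ω : EReal) = S.l₁} = 0) :
    ∃ x, 0 ≤ x ∧ x ≤ l ∧
      ∀ r p, 0 ≤ r → r ≤ l → 0 ≤ p → S.dispatchCost l x 0 ≤ S.dispatchCost l r p := by
  have := S.isProbabilityMeasure
  obtain ⟨x₂, hx₂, hx0, hge, hlt⟩ := S.exists_l₂_eq hc
  rw [hx₂] at h hatom
  have hdu := sub_nonneg.2 S.cDown_le_cUp
  refine ⟨min x₂ l, le_min hx0 hl, min_le_right _ _, fun r p hr hrl hp =>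
    S.dispatchCost_zero_le l hp ?_ ?_ ?_⟩
  · rcases lt_or_ge ((min x₂ l : ℝ) : EReal) S.l₁ with hlt₁ | hge₁
    · exact S.F_mul_le_of_lt_l₁ hlt₁
    -- Here `min x₂ l = x₂ = l₁`; the mass strictly below this point is bounded by a limit from the
    -- left, and there is no atom at the point itself.
    · have hx : ((min x₂ l : ℝ) : EReal) ≤ x₂ := EReal.coe_le_coe_iff.2 (min_le_left _ _)
      have h1 : S.l₁ = x₂ := le_antisymm (hge₁.trans hx) h
      have h2 : min x₂ l = x₂ :=
        EReal.coe_eq_coe_iff.1 (le_antisymm hx (h.trans hge₁))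
      rw [h2]
      have h3 : S.P {ω | S.W ω = x₂} = 0 := by
        have := hatom h1
        rw [h1] at this
        simpa only [EReal.coe_eq_coe_iff] using this
      have h4 : S.F x₂ ≤ S.P.real {ω | S.W ω < x₂} := by
        have hu : {ω | S.W ω ≤ x₂} = {ω | S.W ω < x₂} ∪ {ω | S.W ω = x₂} := by
          ext ω
          exact le_iff_lt_or_eq (a := S.W ω) (b := x₂)
        have := measureReal_union_le (μ := S.P) {ω | S.W ω < x₂} {ω | S.W ω = x₂}
        rw [← hu] at this
        have h5 : S.P.real {ω | S.W ω = x₂} = 0 := by simp [Measure.real, h3]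
        rw [h5, add_zero] at this
        exact this
      have h6 : S.P.real {ω | S.W ω < x₂} * (S.cUp - S.cDown) ≤ S.cF - S.cDown :=
        le_of_tendsto' ((S.tendsto_F_left x₂).mul_const _) fun n => S.F_mul_le_of_lt_l₁ (by
          rw [h1]
          exact EReal.coe_lt_coe_iff.2 (sub_lt_self _ (by positivity)))
      exact (mul_le_mul_of_nonneg_right h4 hdu).trans h6
  · intro hxr
    have : min x₂ l = x₂ := by
      rcases min_choice x₂ l with h' | h'
      · exact h'
      · rw [h'] at hxr
        exact absurd hrl (not_le.2 hxr)
    rw [this]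
    exact hge
  · intro hrx
    have hpos : 0 < min x₂ l := hr.trans_lt hrx
    have hlim := ((S.tendsto_F_left (min x₂ l - S.capF)).const_mul (S.v - S.cUp)).add
      ((S.tendsto_F_left (min x₂ l)).const_mul S.cUp)
    refine le_of_tendsto hlim ?_
    have h0 := (tendsto_one_div_add_atTop_nhds_zero_nat (𝕜 := ℝ)).eventually (gt_mem_nhds hpos)
    filter_upwards [h0] with n hn
    have hn' : 0 < 1 / ((n : ℝ) + 1) := by positivity
    have := hlt (min x₂ l - 1 / ((n : ℝ) + 1)) (by linarith)
      (by linarith [min_le_left x₂ l])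
    rw [sub_right_comm] at this
    exact this.le

/-! ### Optimal dispatches in merit order -/

lemma not_violatesMeritOrder_iff (S : PowerSystem Ω) (hc : S.cI < S.cF) (x : MarketPlan Ω) :
    ¬ S.ViolatesMeritOrder x ↔ S.capI ≤ x.pI ∨ x.pF ≤ 0 := by
  simp only [ViolatesMeritOrder, hc, hc.not_gt, true_and, false_and, or_false, not_and_or, not_lt]

/-- Each of the four hypotheses yields an optimal dispatch that respects the merit order:
either the inflexible units run at capacity or no flexible unit is dispatched. -/
lemma exists_isMinOn_meritOrder (S : PowerSystem Ω) (hc : S.cI < S.cF) {l : ℝ} (hl : 0 ≤ l)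
    (hcase :
      (S.l₂ ≤ S.l₁ ∧ (S.l₁ = S.l₂ → S.P {ω | (S.W ω : EReal) = S.l₁} = 0)) ∨
      (∃ x : MarketPlan Ω, S.IsStochasticSolution l x ∧ ¬ S.ViolatesMeritOrder x) ∨
      (∃ x : MarketPlan Ω, S.IsStochasticSolution l x ∧ x.pI = S.capI) ∨
      (S.cF = S.cUp ∧ S.cUp = S.cDown)) :
    ∃ r p, (r, p) ∈ S.dispatchSet l ∧ (r = l - S.capI ∨ p = 0) ∧
      ∀ r' p', (r', p') ∈ S.dispatchSet l → S.dispatchCost l r p ≤ S.dispatchCost l r' p' := by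
  have hsol : (∃ x : MarketPlan Ω, S.IsStochasticSolution l x ∧ ¬ S.ViolatesMeritOrder x) →
      ∃ r p, (r, p) ∈ S.dispatchSet l ∧ (r = l - S.capI ∨ p = 0) ∧
        ∀ r' p', (r', p') ∈ S.dispatchSet l →
          S.dispatchCost l r p ≤ S.dispatchCost l r' p' := by
    rintro ⟨x, ⟨hx, hmin⟩, hv⟩
    refine ⟨l - x.pI, x.pF, hx.mem_dispatchSet, ?_, fun r' p' h' => ?_⟩
    · rcases (S.not_violatesMeritOrder_iff hc x).1 hv with h | h
      · exact Or.inl (by rw [le_antisymm hx.pI_mem.2 h])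
      · exact Or.inr (le_antisymm h hx.pF_mem.1)
    · rw [← S.expectedCost_optimalPlan h']
      exact hx.dispatchCost_le.trans (hmin _ (S.stochasticFeasible_optimalPlan h'))
  obtain ⟨r, p, hmem, hmin⟩ := S.exists_isMinOn_dispatchCost hl
  obtain ⟨⟨⟨hr, hrI⟩, hrl⟩, hp, hpF⟩ := S.mem_dispatchSet.1 hmem
  rcases hcase with ⟨h, hatom⟩ | h | ⟨x, hx, hxI⟩ | ⟨h, h'⟩
  · obtain ⟨x, hx0, hxl, hx⟩ := S.exists_dispatchCost_zero_le hc hl h hatom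
    rcases le_or_gt (l - S.capI) x with hxI | hxI
    · refine ⟨x, 0, S.mem_dispatchSet.2 ⟨⟨⟨hx0, hxI⟩, hxl⟩, le_rfl, S.capF_pos.le⟩, Or.inr rfl,
        fun r' p' h' => ?_⟩
      obtain ⟨⟨⟨hr', -⟩, hrl'⟩, hp', -⟩ := S.mem_dispatchSet.1 h'
      exact hx r' p' hr' hrl' hp'
    -- The segment from `(x, 0)` to an optimal dispatch crosses the line `r = l - capI`, and by
    -- convexity the crossing point is optimal as well.
    · have hxr : 0 < r - x := by linarith
      set t := (l - S.capI - x) / (r - x) with ht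
      have ht0 : 0 ≤ t := div_nonneg (by linarith) hxr.le
      have ht1 : t ≤ 1 := (div_le_one hxr).2 (by linarith)
      have htr : (1 - t) * x + t * r = l - S.capI := by
        have : t * (r - x) = l - S.capI - x := div_mul_cancel₀ _ hxr.ne'
        linarith
      have hconv := S.dispatchCost_convex l (r₁ := x) (p₁ := 0) (r₂ := r) (p₂ := p) ht0 ht1
      rw [htr] at hconv
      have hxle := mul_le_mul_of_nonneg_left (hx r p hr hrl hp) (sub_nonneg.2 ht1)
      refine ⟨l - S.capI, (1 - t) * 0 + t * p, S.mem_dispatchSet.2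
        ⟨⟨⟨by linarith, le_rfl⟩, by linarith [S.capI_pos]⟩, ?_, ?_⟩, Or.inl rfl,
        fun r' p' h' => le_trans ?_ (hmin r' p' h')⟩
      · linarith [mul_nonneg ht0 hp]
      · linarith [mul_le_mul_of_nonneg_right ht1 hp]
      · linarith
  · exact hsol h
  · exact hsol ⟨x, hx, (S.not_violatesMeritOrder_iff hc x).2 (Or.inl hxI.ge)⟩
  · refine ⟨r, 0, S.mem_dispatchSet.2 ⟨⟨⟨hr, hrI⟩, hrl⟩, le_rfl, S.capF_pos.le⟩, Or.inr rfl,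
      fun r' p' hm' => le_trans ?_ (hmin r' p' hm')⟩
    have := S.dispatchCost_le_of_forall (l := l) (r := r) (p := 0) (r' := r) (p' := p) (c := 0)
      fun ω => by linarith [S.recourse_zero_le_of_eq h h' r p (S.W ω)]
    linarith

/-- An optimal dispatch in merit order can be chosen such that the stochastic dispatch `r - p`
lies between `0` and `capW`. -/
lemma exists_isMinOn_meritOrder_mem_Icc (S : PowerSystem Ω) (hc : S.cI < S.cF) {l r p : ℝ}
    (hl_cap : l ≤ S.capI + S.capF + S.capW) (hmem : (r, p) ∈ S.dispatchSet l)
    (hmerit : r = l - S.capI ∨ p = 0)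
    (hmin : ∀ r' p', (r', p') ∈ S.dispatchSet l → S.dispatchCost l r p ≤ S.dispatchCost l r' p') :
    ∃ p', (r, p') ∈ S.dispatchSet l ∧ (r = l - S.capI ∨ p' = 0) ∧
      (0 ≤ r - p' ∧ r - p' ≤ S.capW) ∧ S.dispatchCost l r p' ≤ S.dispatchCost l r p := by
  obtain ⟨⟨⟨hr, hrI⟩, hrl⟩, hp, hpF⟩ := S.mem_dispatchSet.1 hmem
  have hW := S.capW_pos
  by_cases hrI' : r = l - S.capI
  · rcases le_or_gt p r with hpr | hpr
    · rcases le_or_gt (r - p) S.capW with hpW | hpW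
      · exact ⟨p, hmem, hmerit, ⟨by linarith, hpW⟩, le_rfl⟩
      · refine ⟨r - S.capW, S.mem_dispatchSet.2
          ⟨⟨⟨hr, hrI⟩, hrl⟩, by linarith, by linarith⟩, Or.inl hrI',
          ⟨by linarith, by linarith⟩, ?_⟩
        have := S.dispatchCost_le_of_forall (l := l) (r := r) (p := r - S.capW) (r' := r)
          (p' := p) (c := 0) fun ω => by
            linarith [S.recourse_raise_le (r := r) (p := p) (p' := r - S.capW) (w := S.W ω)
              (by linarith) (by linarith) (by linarith [S.W_le ω])]
        linarith
    · refine ⟨r, S.mem_dispatchSet.2 ⟨⟨⟨hr, hrI⟩, hrl⟩, hr, by linarith⟩, Or.inl hrI',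
        ⟨by linarith, by linarith⟩, ?_⟩
      have := S.dispatchCost_le_of_forall (l := l) (r := r) (p := r) (r' := r)
        (p' := p) (c := 0) fun ω => by
          linarith [S.recourse_self_le (S.W_nonneg ω) hpr.le hpF]
      linarith
  · obtain rfl : p = 0 := hmerit.resolve_left hrI'
    refine ⟨0, hmem, Or.inr rfl, ⟨by linarith, ?_⟩, le_rfl⟩
    -- Otherwise residual demand is certain to remain, and raising the inflexible dispatch,
    -- which is not at capacity, would be strictly cheaper.
    by_contra! hrW
    have hlt : max (l - S.capI) S.capW < r :=
      max_lt (lt_of_le_of_ne hrI (Ne.symm hrI')) (by linarith)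
    have hle := le_max_right (l - S.capI) S.capW
    have hle' := le_max_left (l - S.capI) S.capW
    set r' := max (l - S.capI) S.capW
    have h1 := hmin r' 0 (S.mem_dispatchSet.2
      ⟨⟨⟨by linarith, hle'⟩, by linarith⟩, le_rfl, S.capF_pos.le⟩)
    have h2 := S.dispatchCost_le_of_forall (l := l) (r := r') (p := 0) (r' := r) (p' := 0)
      (c := (S.cUp - S.cI) * (r - r')) fun ω => by
        linarith [S.recourse_zero_add_le ((S.W_le ω).trans hle) hlt.le]
    have h3 : 0 < (S.cUp - S.cI) * (r - r') :=
      mul_pos (by linarith [S.cF_le_cUp]) (by linarith)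
    linarith

/-! ### Comparison of the two problems -/

lemma BilevelFeasible.stochasticFeasible {S : PowerSystem Ω} {l : ℝ} {x : MarketPlan Ω}
    (h : S.BilevelFeasible l x) : S.StochasticFeasible l x := by
  obtain ⟨hbal, hF, hI⟩ := h.lower.1
  exact ⟨by linarith, hF, hI, h.balancing⟩

/-- In the forward market the cheapest dispatch is the one in merit order. -/
lemma bilevelFeasible_optimalPlan (S : PowerSystem Ω) (hc : S.cI < S.cF) {l r p : ℝ}
    (hmem : (r, p) ∈ S.dispatchSet l) (hmerit : r = l - S.capI ∨ p = 0)
    (hpW : 0 ≤ r - p ∧ r - p ≤ S.capW) : S.BilevelFeasible l (S.optimalPlan l r p) := by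
  have hfeas := S.stochasticFeasible_optimalPlan hmem
  refine ⟨hpW, hfeas.balancing, ⟨?_, hfeas.pF_mem, hfeas.pI_mem⟩, ?_⟩
  · linarith [hfeas.forward_balance]
  · rintro xF xI ⟨hbal, hF, hI⟩
    simp only [optimalPlan] at hbal ⊢
    have hpx : p ≤ xF := by
      rcases hmerit with rfl | rfl
      · linarith [hI.2]
      · exact hF.1
    have e : S.cI * (xF - p) ≤ S.cF * (xF - p) :=
      mul_le_mul_of_nonneg_right hc.le (sub_nonneg.2 hpx)
    have e' : xI = l - r + p - xF := by linarith
    rw [e']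
    linarith

end PowerSystem

theorem mainTheorem5 {Ω : Type*} [MeasurableSpace Ω] (S : PowerSystem Ω)
    (hc : S.cI < S.cF) (l : ℝ) (hl : 0 ≤ l) (hl_cap : l ≤ S.capI + S.capF + S.capW)
    (hcase :
      (S.l₂ ≤ S.l₁ ∧ (S.l₁ = S.l₂ → S.P {ω | (S.W ω : EReal) = S.l₁} = 0)) ∨
      (∃ x : MarketPlan Ω, S.IsStochasticSolution l x ∧ ¬ S.ViolatesMeritOrder x) ∨
      (∃ x : MarketPlan Ω, S.IsStochasticSolution l x ∧ x.pI = S.capI) ∨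
      (S.cF = S.cUp ∧ S.cUp = S.cDown)) :
    (∃ x : MarketPlan Ω, S.IsStochasticSolution l x) ∧
    (∃ y : MarketPlan Ω, S.IsBilevelSolution l y) ∧
    (∀ x y : MarketPlan Ω, S.IsStochasticSolution l x → S.IsBilevelSolution l y →
      S.expectedCost y = S.expectedCost x) := by
  obtain ⟨r, p₀, hmem₀, hmerit₀, hmin⟩ := S.exists_isMinOn_meritOrder hc hl hcase
  obtain ⟨p, hmem, hmerit, hpW, hle⟩ :=
    S.exists_isMinOn_meritOrder_mem_Icc hc hl_cap hmem₀ hmerit₀ hmin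
  have hb := S.bilevelFeasible_optimalPlan hc hmem hmerit hpW
  have hopt : ∀ y : MarketPlan Ω, S.StochasticFeasible l y →
      S.expectedCost (S.optimalPlan l r p) ≤ S.expectedCost y := fun y hy => by
    rw [S.expectedCost_optimalPlan hmem]
    exact (hle.trans (hmin _ _ hy.mem_dispatchSet)).trans hy.dispatchCost_le
  refine ⟨⟨_, hb.stochasticFeasible, hopt⟩, ⟨_, hb, fun y hy => hopt y hy.stochasticFeasible⟩,
    fun x y hx hy => le_antisymm ?_ (hx.2 y hy.1.stochasticFeasible)⟩
  exact (hy.2 _ hb).trans (hopt x hx.1)
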